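/- Broadcasting in a finite simple connected graph $G$ starts from one informed vertex $u$ (the originator) and proceeds in discrete time units. In each time unit any number of calls take place in parallel; each call goes from an informed vertex to an uninformed neighbour, which thereby becomes informed, and each vertex participates in at most one call per time unit. Let $b(u)$ be the minimum number of time units after which all vertices can be informed, starting from $u$, and let $b(G)=\max_{u} b(u)$. A connected graph $G$ on $n$ vertices is a broadcast graph if $b(G)=\lceil\log_2 n\rceil$, and $B(n)$ is the minimum number of edges of a broadcast graph on $n$ vertices. Theorem. Let $t,k,n$ be positive integers with $t\ge 7$ and $2\le k\le\lfloor t/2\rfloor-1$; if $n$ is odd, it is enough that $2\le k\le\lceil t/2\rceil-1$. Let $N=(2^k-1)2^{t+1-k}$. 1. If $n=N$, then $$B(n)\le (k+1)N-\Bigl(t-\frac k2+2\Bigr)2^k+t-k+2.$$ 2. If $2^t<n<N$, then $$B(n)\le (k+1-p)\,n-\Bigl(t-\frac k2+p+2\Bigr)2^k+t-k-(p-2)2^p,$$ where $d=N-n$, $x=\lfloor d/2^{t+1-k}\rfloor$, and $p=\lfloor\log_2(x+1)\rfloor$ if $x>0$, $p=0$ otherwise. -/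

import Mathlib

namespace Broadcast

/-- A call `c = (a, b)` is placed by `a` and received by `b`; `Participates v c` says that
`v` is one of its two parties. -/
def Participates {V : Type*} (v : V) (c : V × V) : Prop := v = c.1 ∨ v = c.2

/-- `Step G S S'`: in one time unit the set of informed vertices can pass from `S` to `S'`.
Finitely or infinitely many calls are made in parallel; each goes from an informed vertex to an
uninformed neighbour, and no vertex participates in two different calls. -/
def Step {V : Type*} (G : SimpleGraph V) (S S' : Set V) : Prop :=
  ∃ C : Set (V × V),
    (∀ c ∈ C, c.1 ∈ S ∧ c.2 ∉ S ∧ G.Adj c.1 c.2) ∧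
    (∀ c ∈ C, ∀ c' ∈ C, ∀ v, Participates v c → Participates v c' → c = c') ∧
    S' = S ∪ Prod.snd '' C

/-- Broadcasting from the originator `u` can be completed in `τ` time units; `I i` is the set of
vertices informed after `i` time units. -/
def CompletesIn {V : Type*} (G : SimpleGraph V) (u : V) (τ : ℕ) : Prop :=
  ∃ I : ℕ → Set V, I 0 = {u} ∧ (∀ i < τ, Step G (I i) (I (i + 1))) ∧ I τ = Set.univ

/-- The broadcast time `b(u)`: the least number of time units in which broadcasting from `u` can
be completed (`⊤` if it cannot be completed at all). -/
noncomputable def vertexTime {V : Type*} (G : SimpleGraph V) (u : V) : ℕ∞ :=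
  ⨅ τ ∈ {τ : ℕ | CompletesIn G u τ}, (τ : ℕ∞)

/-- The broadcast time `b(G) = max_u b(u)` of a graph. -/
noncomputable def graphTime {V : Type*} (G : SimpleGraph V) : ℕ∞ :=
  ⨆ u, vertexTime G u

/-- A broadcast graph on `n` vertices: connected, with `b(G) = ⌈log₂ n⌉`. -/
def IsBroadcastGraph {n : ℕ} (G : SimpleGraph (Fin n)) : Prop :=
  G.Connected ∧ graphTime G = (Nat.clog 2 n : ℕ∞)

/-- The numbers of edges of the broadcast graphs on `n` vertices. -/
def sizes (n : ℕ) : Set ℕ :=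
  {e | ∃ G : SimpleGraph (Fin n), IsBroadcastGraph G ∧ G.edgeSet.ncard = e}

/-- The broadcast number `B(n)`: the minimum number of edges of a broadcast graph on `n`
vertices (a genuine minimum whenever `sizes n` is nonempty). -/
noncomputable def B (n : ℕ) : ℕ := sInf (sizes n)

end Broadcast

/-!
Plant a binomial tree of dimension `s` at each vertex of the product of a `q`-dimensional cube
without its vertex `∅` and an `m`-dimensional cube, and cut the trees down to `n` vertices in all,
where `q + m + s = t + 1`. Broadcasting runs through the dimensions of the outer cube, of the inner
cube and of the trees. A root avoids the missing vertex `∅` by the order of the dimensions. A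
non-root vertex first informs the root of its own tree and then acts as the missing vertex, whose
neighbours it reaches by `q - 1` additional edges; the root can be called because every vertex of a
tree is joined to it.

For `q = k` and `m = 0` this gives the bound for `n = N`. When `n` is smaller, it still fits into
the construction with `q = k - p`, which has fewer edges at each non-root vertex; the choice
`m = p + 3` keeps the number of non-root vertices small.
-/

namespace Broadcast

open Finset
open scoped symmDiff

section Schemes

variable {V W : Type*} {G : SimpleGraph V} {A B C : Set V} {m m' : ℕ} {u : V}

/-- `Reach G m A B`: in `m` time units the set of informed vertices can pass from `A` to `B`. -/
inductive Reach (G : SimpleGraph V) : ℕ → Set V → Set V → Prop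
  | refl (A : Set V) : Reach G 0 A A
  | tail {m : ℕ} {A B C : Set V} : Reach G m A B → Step G B C → Reach G (m + 1) A C

theorem Step.subset (h : Step G A B) : A ⊆ B := by
  obtain ⟨_, -, -, rfl⟩ := h
  exact Set.subset_union_left

theorem Step.of_caller (hAB : A ⊆ B) (c : V → V) (hc : ∀ v ∈ B \ A, c v ∈ A ∧ G.Adj (c v) v)
    (hinj : Set.InjOn c (B \ A)) : Step G A B := by
  refine ⟨(fun v => (c v, v)) '' (B \ A), ?_, ?_, ?_⟩
  · rintro _ ⟨v, hv, rfl⟩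
    exact ⟨(hc v hv).1, hv.2, (hc v hv).2⟩
  · rintro _ ⟨v, hv, rfl⟩ _ ⟨w, hw, rfl⟩ x (rfl | rfl) (hx | hx)
    · rw [hinj hv hw hx]
    · exact absurd ((show c v = w from hx) ▸ (hc v hv).1) hw.2
    · exact absurd ((show x = c w from hx) ▸ (hc w hw).1) hv.2
    · rw [show x = w from hx]
  · simp [Set.image_image, Set.union_eq_self_of_subset_left hAB]

theorem Step.ncard_le [Finite V] (h : Step G A B) : B.ncard ≤ 2 * A.ncard := by
  obtain ⟨C, hC, hC', rfl⟩ := h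
  have hreceivers : (Prod.snd '' C).ncard ≤ C.ncard := Set.ncard_image_le
  have hcallers : C.ncard ≤ A.ncard :=
    Set.ncard_le_ncard_of_injOn Prod.fst (fun c hc => (hC c hc).1) fun c hc c' hc' h =>
      hC' c hc c' hc' c.1 (Or.inl rfl) (Or.inl h)
  have := Set.ncard_union_le A (Prod.snd '' C)
  omega

theorem Step.comap (e : W ↪ V) (h : Step G A B) (hB : B ⊆ Set.range e) :
    Step (G.comap e) (e ⁻¹' A) (e ⁻¹' B) := by
  obtain ⟨C, hC, hC', rfl⟩ := h
  refine ⟨Prod.map e e ⁻¹' C, fun c hc => hC _ hc, fun c hc c' hc' v hv hv' => ?_, ?_⟩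
  · exact e.injective.prodMap e.injective <|
      hC' _ hc _ hc' (e v) (hv.imp (congrArg e) (congrArg e)) (hv'.imp (congrArg e) (congrArg e))
  · ext w
    refine or_congr_right ⟨?_, ?_⟩
    · rintro ⟨⟨a, b⟩, hab, rfl⟩
      obtain ⟨a, rfl⟩ := hB (Or.inl (hC _ hab).1)
      exact ⟨(a, w), hab, rfl⟩
    · rintro ⟨c, hc, rfl⟩
      exact ⟨_, hc, rfl⟩

theorem Reach.trans (h : Reach G m A B) (h' : Reach G m' B C) : Reach G (m + m') A C := by
  induction h' with
  | refl => exact h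
  | tail _ hstep ih => exact (ih h).tail hstep

theorem Reach.comap (e : W ↪ V) (h : Reach G m A B) (hB : B ⊆ Set.range e) :
    Reach (G.comap e) m (e ⁻¹' A) (e ⁻¹' B) := by
  induction h with
  | refl => exact .refl _
  | tail _ hstep ih => exact (ih (hstep.subset.trans hB)).tail (hstep.comap e hB)

theorem Reach.exists_sequence (h : Reach G m A B) :
    ∃ I : ℕ → Set V, I 0 = A ∧ (∀ i < m, Step G (I i) (I (i + 1))) ∧ I m = B := by
  induction h with
  | refl A => exact ⟨fun _ => A, rfl, by simp, rfl⟩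
  | @tail m A B C _ hstep ih =>
    obtain ⟨I, hI₀, hI, rfl⟩ := ih
    refine ⟨Function.update I (m + 1) C, by simpa, fun i hi => ?_, by simp⟩
    rcases (Nat.lt_succ_iff.1 hi).lt_or_eq with hi | rfl
    · simpa [Function.update_of_ne, hi.ne, (hi.trans (Nat.lt_succ_self m)).ne] using hI i hi
    · simpa using hstep

/-- Each vertex `v` of `T \ A` is called at time `τ v` by `c v`. -/
theorem Reach.of_schedule {T : Set V} (hAT : A ⊆ T) (τ : V → ℕ) (c : V → V)
    (hτ : ∀ v ∈ T \ A, τ v < m) (hadj : ∀ v ∈ T \ A, G.Adj (c v) v)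
    (hc : ∀ v ∈ T \ A, c v ∈ A ∨ c v ∈ T ∧ τ (c v) < τ v)
    (hinj : ∀ v ∈ T \ A, ∀ w ∈ T \ A, τ v = τ w → c v = c w → v = w) : Reach G m A T := by
  have hreach : ∀ i, Reach G i A {v ∈ T | v ∈ A ∨ τ v < i} := fun i => by
    induction i with
    | zero => simpa [Set.inter_eq_right.2 hAT, Set.sep_mem_eq] using Reach.refl (G := G) A
    | succ i ih =>
      have hnew : ∀ v ∈ {v ∈ T | v ∈ A ∨ τ v < i + 1} \ {v ∈ T | v ∈ A ∨ τ v < i},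
          v ∈ T \ A ∧ τ v = i := by
        rintro v ⟨⟨hvT, hv⟩, hv'⟩
        simp only [Set.mem_ofPred_eq, hvT, true_and, not_or] at hv'
        have := hv.resolve_left hv'.1
        exact ⟨⟨hvT, hv'.1⟩, by omega⟩
      refine ih.tail (Step.of_caller ?_ c ?_ ?_)
      · exact fun v hv => ⟨hv.1, hv.2.imp_right Nat.lt_succ_of_lt⟩
      · intro v hv
        obtain ⟨hv, hvi⟩ := hnew v hv
        refine ⟨?_, hadj v hv⟩
        rcases hc v hv with h | h
        · exact ⟨hAT h, Or.inl h⟩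
        · exact ⟨h.1, Or.inr (hvi ▸ h.2)⟩
      · intro v hv w hw
        obtain ⟨hv, hvi⟩ := hnew v hv
        obtain ⟨hw, hwi⟩ := hnew w hw
        exact hinj v hv w hw (hvi.trans hwi.symm)
  convert hreach m using 1
  ext v
  exact ⟨fun hv => ⟨hv, or_iff_not_imp_left.2 fun hvA => hτ v ⟨hv, hvA⟩⟩, fun hv => hv.1⟩

/-- Broadcasting dimension by dimension, in the order given by `σ`: the finset `D v` holds the
coordinates in which `v` differs from the informed vertices, `v` is called in the last of these
dimensions, and `c j v` is its caller in dimension `j`. -/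
theorem Reach.of_dimensions {T : Set V} {ι : Type*} [DecidableEq ι] (hAT : A ⊆ T)
    (σ : ι ≃ Fin m) (D : V → Finset ι) (c : ι → V → V) (hD : ∀ v ∈ T \ A, (D v).Nonempty)
    (hadj : ∀ v ∈ T \ A, ∀ j ∈ D v, (∀ i ∈ D v, σ i ≤ σ j) → G.Adj (c j v) v)
    (hc : ∀ v ∈ T \ A, ∀ j ∈ D v, (∀ i ∈ D v, σ i ≤ σ j) →
      c j v ∈ A ∨ c j v ∈ T ∧ D (c j v) = (D v).erase j)
    (hinj : ∀ j, Set.InjOn (c j) {v ∈ T \ A | j ∈ D v}) : Reach G m A T := by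
  have hcall : ∀ v ∈ T \ A, ∃ (i : ℕ) (w : V), ∃ j ∈ D v, (∀ i ∈ D v, σ i ≤ σ j) ∧
      i = σ j ∧ w = c j v := fun v hv => by
    obtain ⟨j, hj, hlast⟩ := exists_max_image (D v) σ (hD v hv)
    exact ⟨_, _, j, hj, hlast, rfl, rfl⟩
  choose! τ caller hcall using hcall
  refine Reach.of_schedule hAT τ caller (fun v hv => ?_) (fun v hv => ?_) (fun v hv => ?_) ?_
  · obtain ⟨j, -, -, hτ, -⟩ := hcall v hv
    exact hτ ▸ (σ j).isLt
  · obtain ⟨j, hj, hlast, -, hw⟩ := hcall v hv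
    exact hw ▸ hadj v hv j hj hlast
  · obtain ⟨j, hj, hlast, hτ, hw⟩ := hcall v hv
    rw [hw, hτ, or_iff_not_imp_left]
    intro hA
    obtain ⟨hT, hDw⟩ := (hc v hv j hj hlast).resolve_left hA
    obtain ⟨i, hi, -, hτw, -⟩ := hcall _ ⟨hT, hA⟩
    rw [hDw, mem_erase] at hi
    exact ⟨hT, hτw ▸ (hlast i hi.2).lt_of_ne (σ.injective.ne hi.1)⟩
  · intro v hv w hw hvw hcaller
    obtain ⟨j, hj, -, hτ, hcj⟩ := hcall v hv
    obtain ⟨i, hi, -, hτ', hci⟩ := hcall w hw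
    obtain rfl : j = i := σ.injective (Fin.ext (hτ ▸ hτ' ▸ hvw))
    exact hinj j ⟨hv, hj⟩ ⟨hw, hi⟩ (hcj ▸ hci ▸ hcaller)

theorem CompletesIn.card_le [Finite V] (h : CompletesIn G u m) : Nat.card V ≤ 2 ^ m := by
  obtain ⟨I, hI₀, hI, hIm⟩ := h
  have hcard : ∀ i ≤ m, (I i).ncard ≤ 2 ^ i := fun i => by
    induction i with
    | zero => simp [hI₀]
    | succ i ih =>
      intro hi
      rw [pow_succ']
      exact (hI i hi).ncard_le.trans (Nat.mul_le_mul_left 2 (ih (Nat.le_of_succ_le hi)))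
  simpa [hIm, Set.ncard_univ] using hcard m le_rfl

theorem CompletesIn.reachable (h : CompletesIn G u m) (v : V) : G.Reachable u v := by
  obtain ⟨I, hI₀, hI, hIm⟩ := h
  have hreachable : ∀ i ≤ m, ∀ v ∈ I i, G.Reachable u v := fun i => by
    induction i with
    | zero =>
      rintro - v hv
      rw [hI₀] at hv
      rw [hv]
    | succ i ih =>
      intro hi v hv
      obtain ⟨C, hC, -, hS⟩ := hI i hi
      rw [hS] at hv
      rcases hv with hv | ⟨c, hc, rfl⟩
      · exact ih (Nat.le_of_succ_le hi) v hv
      · exact (ih (Nat.le_of_succ_le hi) _ (hC c hc).1).trans (hC c hc).2.2.reachable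
  exact hreachable m le_rfl v (hIm ▸ Set.mem_univ v)

theorem IsBroadcastGraph.of_completesIn {n : ℕ} [NeZero n] {G : SimpleGraph (Fin n)}
    (h : ∀ u, CompletesIn G u (Nat.clog 2 n)) : IsBroadcastGraph G := by
  have htime : ∀ u, vertexTime G u = (Nat.clog 2 n : ℕ∞) := fun u =>
    le_antisymm (iInf₂_le _ (h u)) <| le_iInf₂ fun τ hτ => by
      have hcard : n ≤ 2 ^ τ := by simpa using CompletesIn.card_le hτ
      exact_mod_cast Nat.clog_le_of_le_pow hcard
  exact ⟨⟨fun u v => (h u).reachable v⟩, by simp [graphTime, htime]⟩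

end Schemes

section Construction

/-- A vertex `((z, y), a)`: a pair `(z, y)` of vertices of the cubes of dimensions `q` (the outer
cube) and `m` (the inner cube), and a vertex `a` of the binomial tree of dimension `s` planted
there, whose root is `a = ∅`. -/
abbrev Vertex (q m s : ℕ) := (Finset (Fin q) × Finset (Fin m)) × Finset (Fin s)

variable {q m s : ℕ} {S : Finset (Vertex q m s)}

/-- The roots of the binomial trees: the outer cube loses its vertex `∅`. -/
def roots (q m : ℕ) : Finset (Finset (Fin q) × Finset (Fin m)) := {∅}ᶜ ×ˢ univ

/-- The parent of a vertex of a binomial tree. -/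
def parent (a : Finset (Fin s)) : Finset (Fin s) := {i ∈ a | (i : WithBot (Fin s)) ≠ a.max}

/-- The vertex sets of the construction: every binomial tree is cut down to a subtree that retains
all vertices of depth at most one. -/
structure IsTrimming (S : Finset (Vertex q m s)) : Prop where
  fst_mem : ∀ v ∈ S, v.1 ∈ roots q m
  mem_of_card_le_one : ∀ x ∈ roots q m, ∀ a : Finset (Fin s), #a ≤ 1 → (x, a) ∈ S
  erase_mem : ∀ v ∈ S, ∀ j ∈ v.2, (v.1, v.2.erase j) ∈ S

/-- The edges of the binomial trees. -/
def treeEdges (S : Finset (Vertex q m s)) : Finset (Sym2 (Vertex q m s)) :=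
  {v ∈ S | 0 < #v.2}.image fun v => s(v, (v.1, parent v.2))

/-- The edges joining the vertices of depth at least two to the roots of their trees. -/
def shortcutEdges (S : Finset (Vertex q m s)) : Finset (Sym2 (Vertex q m s)) :=
  {v ∈ S | 1 < #v.2}.image fun v => s(v, (v.1, ∅))

/-- The edges that let a non-root vertex over `(z, y)` act as the missing vertex `∅` of the outer
cube: they lead to the neighbours `{j}` of `∅`, except in the direction `j = min z`. -/
def linkEdges (S : Finset (Vertex q m s)) : Finset (Sym2 (Vertex q m s)) :=
  {v ∈ S | 0 < #v.2}.biUnion fun v =>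
    ({j | v.1.1.min ≠ (j : WithTop (Fin q))} : Finset (Fin q)).image fun j =>
      s(v, (({j}, v.1.2), ∅))

/-- The edges between roots in the directions of the outer cube. -/
def outerEdges (q m s : ℕ) : Finset (Sym2 (Vertex q m s)) :=
  univ.biUnion fun j => (Ioi {j} ×ˢ univ).image fun x => s((x, ∅), ((x.1.erase j, x.2), ∅))

/-- The edges between roots in the directions of the inner cube. -/
def innerEdges (q m s : ℕ) : Finset (Sym2 (Vertex q m s)) :=
  univ.biUnion fun j => ({∅}ᶜ ×ˢ Ici {j}).image fun x => s((x, ∅), ((x.1, x.2.erase j), ∅))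

/-- The edges of the construction with vertex set `S`. -/
def treeCubeEdges (S : Finset (Vertex q m s)) : Finset (Sym2 (Vertex q m s)) :=
  treeEdges S ∪ shortcutEdges S ∪ linkEdges S ∪ outerEdges q m s ∪ innerEdges q m s

/-- The graph of the construction with vertex set `S`; the vertices outside `S` play no role. -/
def treeCube (S : Finset (Vertex q m s)) : SimpleGraph (Vertex q m s) :=
  SimpleGraph.fromEdgeSet (treeCubeEdges S)

theorem mem_roots {x : Finset (Fin q) × Finset (Fin m)} : x ∈ roots q m ↔ x.1.Nonempty := by
  simp [roots, nonempty_iff_ne_empty]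

theorem IsTrimming.root_mem (hS : IsTrimming S) {x : Finset (Fin q) × Finset (Fin m)}
    (hx : x.1.Nonempty) : (x, ∅) ∈ S :=
  hS.mem_of_card_le_one x (mem_roots.2 hx) ∅ (by simp)

theorem IsTrimming.fst_nonempty (hS : IsTrimming S) {v : Vertex q m s} (hv : v ∈ S) :
    v.1.1.Nonempty :=
  mem_roots.1 (hS.fst_mem v hv)

theorem parent_eq_erase {a : Finset (Fin s)} {j : Fin s} (hj : j ∈ a) (hmax : ∀ i ∈ a, i ≤ j) :
    parent a = a.erase j := by
  have : a.max = j := le_antisymm (Finset.max_le fun i hi => mod_cast hmax i hi) (le_max hj)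
  simp [parent, this, filter_ne']

theorem symmDiff_singleton_of_mem {ι : Type*} [DecidableEq ι] {a : Finset ι} {j : ι} (hj : j ∈ a) :
    a ∆ {j} = a.erase j := by
  rw [symmDiff_of_ge (singleton_subset_iff.2 hj), sdiff_singleton_eq_erase]

theorem treeCube_adj {v w : Vertex q m s} :
    (treeCube S).Adj v w ↔ s(v, w) ∈ treeCubeEdges S ∧ v ≠ w := by
  simp [treeCube]

theorem adj_erase {x : Finset (Fin q) × Finset (Fin m)} {a : Finset (Fin s)} {j : Fin s}
    (hv : (x, a) ∈ S) (hj : j ∈ a) (hmax : ∀ i ∈ a, i ≤ j) :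
    (treeCube S).Adj (x, a.erase j) (x, a) := by
  refine (treeCube_adj.2 ⟨?_, ?_⟩).symm
  · simp only [treeCubeEdges, mem_union]
    refine .inl <| .inl <| .inl <| .inl <| mem_image.2 ⟨(x, a), ?_, ?_⟩
    · exact mem_filter.2 ⟨hv, card_pos.2 ⟨j, hj⟩⟩
    · simp [parent_eq_erase hj hmax]
  · simpa using (erase_ssubset hj).ne'

theorem adj_root {x : Finset (Fin q) × Finset (Fin m)} {a : Finset (Fin s)} (hv : (x, a) ∈ S)
    (ha : a.Nonempty) : (treeCube S).Adj (x, a) (x, ∅) := by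
  rcases (Nat.one_le_iff_ne_zero.2 ha.card_ne_zero).eq_or_lt with h | h
  · obtain ⟨i, rfl⟩ := card_eq_one.1 h.symm
    simpa using (adj_erase hv (mem_singleton_self i) (by simp)).symm
  · refine treeCube_adj.2 ⟨?_, by simpa using ha.ne_empty⟩
    simp only [treeCubeEdges, mem_union]
    exact .inl <| .inl <| .inl <| .inr <| mem_image.2 ⟨(x, a), mem_filter.2 ⟨hv, h⟩, rfl⟩

theorem adj_link {x : Finset (Fin q) × Finset (Fin m)} {a : Finset (Fin s)} {j : Fin q}
    (hv : (x, a) ∈ S) (ha : a.Nonempty) (hj : x.1.min ≠ j) :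
    (treeCube S).Adj (x, a) (({j}, x.2), ∅) := by
  refine treeCube_adj.2 ⟨?_, by simp [ha.ne_empty]⟩
  simp only [treeCubeEdges, mem_union]
  exact .inl <| .inl <| .inr <| mem_biUnion.2
    ⟨(x, a), mem_filter.2 ⟨hv, ha.card_pos⟩, mem_image.2 ⟨j, by simpa using hj, rfl⟩⟩

theorem adj_symmDiff_fst {z : Finset (Fin q)} (y : Finset (Fin m)) {j : Fin q} (hz : z.Nonempty)
    (hz' : (z ∆ {j}).Nonempty) : (treeCube S).Adj ((z ∆ {j}, y), ∅) ((z, y), ∅) := by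
  wlog hj : j ∈ z generalizing z
  · have := this hz' (by simpa using hz) (by simp [mem_symmDiff, hj])
    simpa using this.symm
  rw [symmDiff_singleton_of_mem hj] at hz' ⊢
  refine (treeCube_adj.2 ⟨?_, by simpa using (erase_ssubset hj).ne'⟩).symm
  simp only [treeCubeEdges, mem_union]
  refine .inl <| .inr <| mem_biUnion.2 ⟨j, mem_univ _, mem_image.2 ⟨(z, y), ?_, rfl⟩⟩
  have hne : z ≠ {j} := by
    rintro rfl
    simp at hz'
  simpa [hne.symm] using (singleton_subset_iff.2 hj).ssubset_of_ne hne.symm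

theorem adj_symmDiff_snd {z : Finset (Fin q)} (y : Finset (Fin m)) (j : Fin m)
    (hz : z.Nonempty) : (treeCube S).Adj ((z, y ∆ {j}), ∅) ((z, y), ∅) := by
  wlog hj : j ∈ y generalizing y
  · have := this (y ∆ {j}) (by simp [mem_symmDiff, hj])
    simpa using this.symm
  rw [symmDiff_singleton_of_mem hj]
  refine (treeCube_adj.2 ⟨?_, by simpa using (erase_ssubset hj).ne'⟩).symm
  simp only [treeCubeEdges, mem_union]
  refine .inr <| mem_biUnion.2 ⟨j, mem_univ _, mem_image.2 ⟨(z, y), ?_, rfl⟩⟩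
  simpa [hz.ne_empty] using hj

theorem reach_tree (hS : IsTrimming S) (u : Vertex q m s) :
    Reach (treeCube S) s {v | v ∈ S ∧ (v = u ∨ v.2 = ∅)} {v | v ∈ S} := by
  refine Reach.of_dimensions (fun v hv => hv.1) (Equiv.refl _) (fun v => v.2)
    (fun j v => (v.1, v.2.erase j)) ?_ ?_ ?_ ?_
  · exact fun v hv => nonempty_iff_ne_empty.2 fun h => hv.2 ⟨hv.1, Or.inr h⟩
  · exact fun v hv j hj hmax => adj_erase hv.1 hj hmax
  · exact fun v hv j hj _ => Or.inr ⟨hS.erase_mem v hv.1 j hj, rfl⟩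
  · intro j v hv w hw h
    simp only [Prod.mk.injEq] at h
    exact Prod.ext h.1 (erase_injOn' j hv.2 hw.2 h.2)

theorem reach_inner (hS : IsTrimming S) (u : Vertex q m s) (y : Finset (Fin m)) :
    Reach (treeCube S) m {v | v ∈ S ∧ (v = u ∨ v.2 = ∅ ∧ v.1.2 = y)}
      {v | v ∈ S ∧ (v = u ∨ v.2 = ∅)} := by
  have hnew : ∀ v ∈ {v | v ∈ S ∧ (v = u ∨ v.2 = ∅)} \ {v | v ∈ S ∧ (v = u ∨ v.2 = ∅ ∧ v.1.2 = y)},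
      v.1.1.Nonempty ∧ v.2 = ∅ ∧ v.1.2 ≠ y := by
    rintro v ⟨⟨hv, hvu⟩, hv'⟩
    simp only [Set.mem_ofPred_eq, hv, true_and, not_or] at hv'
    have ha := hvu.resolve_left hv'.1
    exact ⟨hS.fst_nonempty hv, ha, fun h => hv'.2 ⟨ha, h⟩⟩
  refine Reach.of_dimensions (fun v hv => ⟨hv.1, hv.2.imp_right And.left⟩) (Equiv.refl _)
    (fun v => v.1.2 ∆ y) (fun j v => ((v.1.1, v.1.2 ∆ {j}), ∅)) ?_ ?_ ?_ ?_
  · exact fun v hv => symmDiff_nonempty.2 (hnew v hv).2.2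
  · rintro ⟨⟨z, y'⟩, a⟩ hv j - -
    obtain ⟨hz, rfl, -⟩ := hnew _ hv
    exact adj_symmDiff_snd y' j hz
  · refine fun v hv j hj _ => Or.inr ⟨⟨hS.root_mem (hnew v hv).1, Or.inr rfl⟩, ?_⟩
    rw [symmDiff_right_comm, symmDiff_singleton_of_mem hj]
  · rintro j ⟨⟨z, y'⟩, a⟩ hv ⟨⟨z', y''⟩, a'⟩ hw h
    obtain ⟨-, rfl, -⟩ := hnew _ hv.1
    obtain ⟨-, rfl, -⟩ := hnew _ hw.1
    simp only [Prod.mk.injEq, symmDiff_left_inj] at h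
    simp [h]

/-- The dimension of a coordinate `p` of the originator comes last, so that no call uses the missing
vertex. -/
theorem reach_outer_of_root (hS : IsTrimming S) {z₀ : Finset (Fin q)} (y : Finset (Fin m))
    (hz₀ : z₀.Nonempty) :
    Reach (treeCube S) q {((z₀, y), ∅)} {v | v ∈ S ∧ v.2 = ∅ ∧ v.1.2 = y} := by
  obtain ⟨p, hp⟩ := hz₀
  have : NeZero q := ⟨fun h => (h ▸ p).elim0⟩
  have hlast : ∀ v : Vertex q m s, ∀ j ∈ v.1.1 ∆ z₀,
      (∀ i ∈ v.1.1 ∆ z₀, Equiv.swap p ⊤ i ≤ Equiv.swap p ⊤ j) →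
      p ∈ v.1.1 ∆ {j} := by
    intro v j hj hmax
    by_cases hpv : p ∈ v.1.1
    · have hjp : j ≠ p := by
        rintro rfl
        simp [mem_symmDiff, hpv, hp] at hj
      simp [mem_symmDiff, hpv, hjp.symm]
    · have hjp : j = p := by
        simpa [Equiv.swap_apply_eq_iff] using hmax p (by simp [mem_symmDiff, hpv, hp])
      simp [mem_symmDiff, hpv, hjp]
  refine Reach.of_dimensions ?_ (Equiv.swap p ⊤) (fun v => v.1.1 ∆ z₀)
    (fun j v => ((v.1.1 ∆ {j}, y), ∅)) ?_ ?_ ?_ ?_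
  · rintro _ rfl
    exact ⟨hS.root_mem ⟨p, hp⟩, rfl, rfl⟩
  · rintro ⟨⟨z, y'⟩, a⟩ ⟨⟨-, rfl, rfl⟩, hv⟩
    exact symmDiff_nonempty.2 fun h => hv (by simp_all)
  · rintro ⟨⟨z, y'⟩, a⟩ ⟨⟨hv, rfl, rfl⟩, -⟩ j hj hmax
    exact adj_symmDiff_fst _ (hS.fst_nonempty hv) ⟨p, hlast _ j hj hmax⟩
  · refine fun v _ j hj hmax => Or.inr ⟨⟨hS.root_mem ⟨p, hlast v j hj hmax⟩, rfl, rfl⟩, ?_⟩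
    rw [symmDiff_right_comm, symmDiff_singleton_of_mem hj]
  · rintro j ⟨⟨z, y'⟩, a⟩ ⟨⟨⟨-, rfl, rfl⟩, -⟩, -⟩ ⟨⟨z', y''⟩, a'⟩ ⟨⟨⟨-, rfl, rfl⟩, -⟩, -⟩ h
    simp only [Prod.mk.injEq, symmDiff_left_inj] at h
    simp [h]

/-- The set of dimensions in which a root over `z` is to be reached from a non-root vertex over
`z₀`: a root with `p ∈ z` is reached through the root over `z₀`, which is informed in dimension `p`,
and a root with `p ∉ z` through the missing vertex `∅`. -/
def route (p : Fin q) (z₀ z : Finset (Fin q)) : Finset (Fin q) :=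
  z ∆ if p ∈ z then z₀.erase p else ∅

theorem mem_route_self {p : Fin q} {z₀ z : Finset (Fin q)} : p ∈ route p z₀ z ↔ p ∈ z := by
  by_cases hp : p ∈ z <;> simp [route, hp, mem_symmDiff]

theorem route_injective (p : Fin q) (z₀ : Finset (Fin q)) : Function.Injective (route p z₀) := by
  intro z z' h
  have hp : p ∈ z ↔ p ∈ z' := by rw [← mem_route_self (z₀ := z₀), h, mem_route_self]
  simpa [route, hp] using h

theorem route_symmDiff_singleton {p j : Fin q} (hjp : j ≠ p) (z₀ z : Finset (Fin q)) :
    route p z₀ (z ∆ {j}) = route p z₀ z ∆ {j} := by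
  have hp : p ∈ z ∆ {j} ↔ p ∈ z := by simp [mem_symmDiff, hjp.symm]
  simp only [route, hp, symmDiff_right_comm]

theorem route_self {p : Fin q} {z₀ : Finset (Fin q)} (hp : p ∈ z₀) : route p z₀ z₀ = {p} := by
  rw [route, if_pos hp, ← symmDiff_singleton_of_mem hp, symmDiff_symmDiff_cancel_left]

theorem route_singleton {p j : Fin q} (hjp : j ≠ p) (z₀ : Finset (Fin q)) :
    route p z₀ {j} = {j} := by
  simp [route, hjp.symm]

theorem route_nonempty {z : Finset (Fin q)} (p : Fin q) (z₀ : Finset (Fin q)) (hz : z.Nonempty) :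
    (route p z₀ z).Nonempty := by
  rw [nonempty_iff_ne_empty] at hz ⊢
  exact fun h => hz (route_injective p z₀ (h.trans (by simp [route])))

theorem symmDiff_singleton_nonempty {p j : Fin q} {z₀ z : Finset (Fin q)} (hjp : j ≠ p)
    (h : route p z₀ z ≠ {j}) : (z ∆ {j}).Nonempty := by
  refine symmDiff_nonempty.2 ?_
  rintro rfl
  exact h (route_singleton hjp z₀)

theorem adj_of_route_eq_singleton {p j : Fin q} {z₀ z : Finset (Fin q)} {y : Finset (Fin m)}
    {a₀ : Finset (Fin s)} (hu : ((z₀, y), a₀) ∈ S) (ha₀ : a₀.Nonempty) (hp : z₀.min = p)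
    (hz : route p z₀ z = {j}) : (treeCube S).Adj ((z₀, y), a₀) ((z, y), ∅) := by
  rcases eq_or_ne j p with rfl | hjp
  · obtain rfl := route_injective j z₀ (hz.trans (route_self (mem_of_min hp)).symm)
    exact adj_root hu ha₀
  · obtain rfl := route_injective p z₀ (hz.trans (route_singleton hjp z₀).symm)
    exact adj_link hu ha₀ (by simpa [hp, eq_comm] using hjp)

/-- The dimension `min z₀` comes first: its only call is then the one from the originator to the
root of its own tree, and the originator serves as the missing vertex in the others. -/
theorem reach_outer_of_nonroot (hS : IsTrimming S) {z₀ : Finset (Fin q)} {y : Finset (Fin m)}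
    {a₀ : Finset (Fin s)} (hu : ((z₀, y), a₀) ∈ S) (ha₀ : a₀.Nonempty) :
    Reach (treeCube S) q {((z₀, y), a₀)}
      {v | v ∈ S ∧ (v = ((z₀, y), a₀) ∨ v.2 = ∅ ∧ v.1.2 = y)} := by
  obtain ⟨p, hp⟩ := min_of_nonempty (hS.fst_nonempty hu)
  have : NeZero q := ⟨fun h => (h ▸ p).elim0⟩
  have hnew : ∀ v ∈ {v | v ∈ S ∧ (v = ((z₀, y), a₀) ∨ v.2 = ∅ ∧ v.1.2 = y)} \ {((z₀, y), a₀)},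
      v.1.1.Nonempty ∧ v = ((v.1.1, y), ∅) := by
    rintro ⟨⟨z, y'⟩, a⟩ ⟨⟨hv, hvu⟩, hne⟩
    obtain ⟨rfl, rfl⟩ := hvu.resolve_left hne
    exact ⟨hS.fst_nonempty hv, rfl⟩
  have hne : ∀ z, ∀ j ∈ route p z₀ z,
      (∀ i ∈ route p z₀ z, Equiv.swap p ⊥ i ≤ Equiv.swap p ⊥ j) → route p z₀ z ≠ {j} → j ≠ p := by
    rintro z j hj hmax hz rfl
    refine hz (eq_singleton_iff_unique_mem.2 ⟨hj, fun i hi => ?_⟩)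
    simpa [Equiv.swap_apply_eq_iff] using hmax i hi
  refine Reach.of_dimensions ?_ (Equiv.swap p ⊥) (fun v => route p z₀ v.1.1)
    (fun j v => if route p z₀ v.1.1 = {j} then ((z₀, y), a₀) else ((v.1.1 ∆ {j}, y), ∅)) ?_ ?_ ?_ ?_
  · rintro _ rfl
    exact ⟨hu, Or.inl rfl⟩
  · exact fun v hv => route_nonempty p z₀ (hnew v hv).1
  · intro v hv j hj hmax
    obtain ⟨hz, hv⟩ := hnew v hv
    split_ifs with hjv
    · exact hv ▸ adj_of_route_eq_singleton hu ha₀ hp hjv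
    · nth_rw 2 [hv]
      exact adj_symmDiff_fst y hz (symmDiff_singleton_nonempty (hne _ j hj hmax hjv) hjv)
  · intro v _ j hj hmax
    split_ifs with hjv
    · exact Or.inl rfl
    · have hjp := hne _ j hj hmax hjv
      refine Or.inr ⟨⟨hS.root_mem (symmDiff_singleton_nonempty hjp hjv), Or.inr ⟨rfl, rfl⟩⟩, ?_⟩
      rw [route_symmDiff_singleton hjp, symmDiff_singleton_of_mem hj]
  · intro j v hv w hw h
    rw [(hnew v hv.1).2, (hnew w hw.1).2]
    suffices v.1.1 = w.1.1 by rw [this]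
    dsimp only at h
    split_ifs at h with hjv hjw hjw
    · exact route_injective p z₀ (hjv.trans hjw.symm)
    · exact absurd (congrArg Prod.snd h) ha₀.ne_empty
    · exact absurd (congrArg Prod.snd h).symm ha₀.ne_empty
    · simpa using h

theorem reach_treeCube (hS : IsTrimming S) {u : Vertex q m s} (hu : u ∈ S) :
    Reach (treeCube S) (q + m + s) {u} {v | v ∈ S} := by
  obtain ⟨⟨z, y⟩, a⟩ := u
  refine (Reach.trans ?_ (reach_inner hS ((z, y), a) y)).trans (reach_tree hS _)
  rcases a.eq_empty_or_nonempty with rfl | ha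
  · convert reach_outer_of_root hS y (hS.fst_nonempty hu) using 1
    ext v
    exact and_congr_right fun _ => ⟨by rintro (rfl | h); exacts [⟨rfl, rfl⟩, h], Or.inr⟩
  · exact reach_outer_of_nonroot hS hu ha

theorem card_compl_singleton_empty (m : ℕ) : #({∅}ᶜ : Finset (Finset (Fin m))) = 2 ^ m - 1 := by
  simp [card_compl]

theorem card_Ici_singleton (j : Fin m) : #(Ici ({j} : Finset (Fin m))) = 2 ^ (m - 1) := by
  rw [← Icc_top, card_Icc_finset (by simp)]
  simp

theorem card_Ioi_singleton (j : Fin m) : #(Ioi ({j} : Finset (Fin m))) = 2 ^ (m - 1) - 1 := by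
  rw [card_Ioi_eq_card_Ici_sub_one, card_Ici_singleton]

theorem card_roots : #(roots q m) = (2 ^ q - 1) * 2 ^ m := by
  simp [roots, card_compl_singleton_empty]

theorem card_filter_card_le_one (s : ℕ) : #{a : Finset (Fin s) | #a ≤ 1} = s + 1 := by
  have : ({a | #a ≤ 1} : Finset (Finset (Fin s))) = insert ∅ (univ.image singleton) := by
    ext a
    simp [Nat.le_one_iff_eq_zero_or_eq_one, card_eq_one, eq_comm]
  rw [this, card_insert_of_notMem (by simp), card_image_of_injective _ singleton_injective]
  simp

theorem IsTrimming.card_filter_lt_add (hS : IsTrimming S) {d : ℕ} (hd : d ≤ 1) :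
    #{v ∈ S | d < #v.2} + #(roots q m) * #{a : Finset (Fin s) | #a ≤ d} = #S := by
  have : {v ∈ S | ¬d < #v.2} = roots q m ×ˢ ({a | #a ≤ d} : Finset (Finset (Fin s))) := by
    ext v
    simp only [mem_filter, mem_product, mem_univ, true_and, not_lt]
    exact ⟨fun h => ⟨hS.fst_mem v h.1, h.2⟩,
      fun h => ⟨hS.mem_of_card_le_one v.1 h.1 v.2 (h.2.trans hd), h.2⟩⟩
  rw [← card_product, ← this, card_filter_add_card_filter_not]

theorem IsTrimming.card_linkEdges_le (hS : IsTrimming S) :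
    #(linkEdges S) ≤ #{v ∈ S | 0 < #v.2} * (q - 1) := by
  refine card_biUnion_le_card_mul _ _ _ fun v hv => card_image_le.trans ?_
  obtain ⟨p, hp⟩ := min_of_nonempty (hS.fst_nonempty (mem_filter.1 hv).1)
  simp [hp, filter_ne]

theorem card_outerEdges_le : #(outerEdges q m s) ≤ q * ((2 ^ (q - 1) - 1) * 2 ^ m) := by
  refine (card_biUnion_le_card_mul univ _ ((2 ^ (q - 1) - 1) * 2 ^ m) fun j _ =>
    card_image_le.trans ?_).trans_eq (by simp)
  simp [card_Ioi_singleton]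

theorem card_innerEdges_le : #(innerEdges q m s) ≤ m * ((2 ^ q - 1) * 2 ^ (m - 1)) := by
  refine (card_biUnion_le_card_mul univ _ ((2 ^ q - 1) * 2 ^ (m - 1)) fun j _ =>
    card_image_le.trans ?_).trans_eq (by simp)
  rw [card_product, card_compl_singleton_empty, card_Ici_singleton]

theorem IsTrimming.card_treeCubeEdges_le (hS : IsTrimming S) :
    #(treeCubeEdges S) ≤ #{v ∈ S | 0 < #v.2} + #{v ∈ S | 1 < #v.2} +
      #{v ∈ S | 0 < #v.2} * (q - 1) + q * ((2 ^ (q - 1) - 1) * 2 ^ m) +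
      m * ((2 ^ q - 1) * 2 ^ (m - 1)) :=
  (card_union_le _ _).trans <| add_le_add
    ((card_union_le _ _).trans <| add_le_add
      ((card_union_le _ _).trans <| add_le_add
        ((card_union_le _ _).trans <| add_le_add card_image_le card_image_le)
        hS.card_linkEdges_le)
      card_outerEdges_le)
    card_innerEdges_le

theorem exists_subset_card_eq_of_lt_mem {α β : Type*} [LinearOrder β] (U : Finset α) (f : α → β)
    {n : ℕ} (hn : n ≤ #U) :
    ∃ S ⊆ U, #S = n ∧ ∀ v ∈ S, ∀ w ∈ U, f w < f v → w ∈ S := by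
  classical
  induction n with
  | zero => exact ⟨∅, by simp⟩
  | succ n ih =>
    obtain ⟨S, hSU, rfl, hS⟩ := ih (Nat.le_of_succ_le hn)
    have hdiff : (U \ S).Nonempty := card_pos.1 (by have := le_card_sdiff S U; omega)
    obtain ⟨x, hx, hmin⟩ := exists_min_image (U \ S) f hdiff
    rw [mem_sdiff] at hx
    refine ⟨insert x S, insert_subset hx.1 hSU, card_insert_of_notMem hx.2, fun v hv w hw hwv => ?_⟩
    refine mem_insert_of_mem ?_
    rcases mem_insert.1 hv with rfl | hv
    · by_contra hwS
      exact (hmin w (mem_sdiff.2 ⟨hw, hwS⟩)).not_gt hwv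
    · exact hS v hv w hw hwv

theorem exists_isTrimming {n : ℕ} (h₁ : (2 ^ q - 1) * 2 ^ m * (s + 1) ≤ n)
    (h₂ : n ≤ (2 ^ q - 1) * 2 ^ m * 2 ^ s) :
    ∃ S : Finset (Vertex q m s), IsTrimming S ∧ #S = n := by
  obtain ⟨S, hS, rfl, hlt⟩ := exists_subset_card_eq_of_lt_mem
    (roots q m ×ˢ (univ : Finset (Finset (Fin s)))) (fun v => #v.2) (n := n)
    (by simpa [card_roots] using h₂)
  have hfst : ∀ v ∈ S, v.1 ∈ roots q m := fun v hv => (mem_product.1 (hS hv)).1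
  refine ⟨S, ⟨hfst, fun x hx a ha => ?_, fun v hv j hj => ?_⟩, rfl⟩
  · by_contra hxa
    have hsub : S ⊆ roots q m ×ˢ ({b | #b ≤ 1} : Finset (Finset (Fin s))) := fun v hv => by
      have : #v.2 ≤ #a := not_lt.1 fun h => hxa (hlt v hv (x, a) (by simpa using hx) h)
      simpa [hfst v hv] using this.trans ha
    have heq := eq_of_subset_of_card_le hsub
      (by rwa [card_product, card_roots, card_filter_card_le_one])
    exact hxa (by simpa [heq, hx] using ha)
  · exact hlt v hv _ (by simpa using hfst v hv) (card_erase_lt_of_mem hj)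

theorem IsTrimming.exists_isBroadcastGraph {t : ℕ} (hS : IsTrimming S) (hs : q + m + s = t + 1)
    (hn : 2 ^ t < #S) :
    ∃ G : SimpleGraph (Fin #S), IsBroadcastGraph G ∧ G.edgeSet.ncard ≤ #(treeCubeEdges S) := by
  have : NeZero #S := ⟨Nat.ne_zero_of_lt hn⟩
  let e : Fin #S ↪ Vertex q m s := S.equivFin.symm.toEmbedding.trans (Function.Embedding.subtype _)
  have he : Set.range e = {v | v ∈ S} := by
    ext v
    exact ⟨fun ⟨i, hi⟩ => hi ▸ (S.equivFin.symm i).2, fun hv => ⟨S.equivFin ⟨v, hv⟩, by simp [e]⟩⟩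
  have hle : #S ≤ 2 ^ (q + m + s) := by
    simpa [pow_add] using S.card_le_univ
  have hclog : Nat.clog 2 #S = q + m + s :=
    le_antisymm (Nat.clog_le_of_le_pow hle) (hs ▸ (Nat.lt_clog_iff_pow_lt one_lt_two).2 hn)
  refine ⟨(treeCube S).comap e, .of_completesIn fun u => ?_, ?_⟩
  · have h := (reach_treeCube hS (S.equivFin.symm u).2).comap e he.ge
    obtain ⟨I, hI₀, hI, hIm⟩ := h.exists_sequence
    refine ⟨I, hI₀.trans (Set.ext fun v => e.injective.eq_iff), hclog ▸ hI, ?_⟩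
    rw [hclog, hIm, ← he, Set.preimage_range]
  · refine le_trans ?_ (Set.ncard_coe_finset (treeCubeEdges S)).le
    refine Set.ncard_le_ncard_of_injOn (Sym2.map e) ?_ (Sym2.map.injective e.injective).injOn
    rintro ⟨v, w⟩ h
    exact (treeCube_adj.1 h).1

end Construction

section Bounds

variable {q m s t k p n w : ℕ}

theorem B_le (hs : q + m + s = t + 1) (hn : 2 ^ t < n)
    (h₁ : (2 ^ q - 1) * 2 ^ m * (s + 1) ≤ n) (h₂ : n ≤ (2 ^ q - 1) * 2 ^ m * 2 ^ s) :
    (sizes n).Nonempty ∧ (B n : ℝ) ≤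
      (q + 1) * n - 2 ^ m * ((t + 2 - 3 * m / 2) * (2 ^ q - 1) - q * (2 ^ q / 2 - 1)) := by
  obtain ⟨r, rfl⟩ : ∃ r, q = r + 1 := Nat.exists_eq_add_one_of_ne_zero <| by
    rintro rfl
    simp_all
  obtain ⟨S, hS, rfl⟩ := exists_isTrimming h₁ h₂
  obtain ⟨G, hG, hcard⟩ := hS.exists_isBroadcastGraph hs hn
  refine ⟨⟨_, G, hG, rfl⟩, ?_⟩
  have hB : B #S ≤ #(treeCubeEdges S) := le_trans (Nat.sInf_le ⟨G, hG, rfl⟩) hcard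
  have hB := (Nat.cast_le (α := ℝ)).2 (hB.trans hS.card_treeCubeEdges_le)
  have hpred : ∀ i : ℕ, ((2 ^ i - 1 : ℕ) : ℝ) = 2 ^ i - 1 := fun i => by simp
  have hpos : (#{v ∈ S | 0 < #v.2} : ℝ) = #S - (2 ^ (r + 1) - 1) * 2 ^ m := by
    have h := congrArg (Nat.cast (R := ℝ)) (hS.card_filter_lt_add zero_le_one)
    simp only [card_roots, card_eq_zero, Nat.le_zero, filter_eq', mem_univ, if_true,
      card_singleton] at h
    push_cast [hpred] at h
    linarith
  have hdeep : (#{v ∈ S | 1 < #v.2} : ℝ) = #S - (2 ^ (r + 1) - 1) * 2 ^ m * (s + 1) := by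
    have h := congrArg (Nat.cast (R := ℝ)) (hS.card_filter_lt_add le_rfl)
    rw [card_roots, card_filter_card_le_one] at h
    push_cast [hpred] at h
    linarith
  have hm : (m : ℝ) * 2 ^ (m - 1) = m / 2 * 2 ^ m := by
    cases m with
    | zero => simp
    | succ m => rw [Nat.add_sub_cancel, pow_succ]; ring
  have hsr : (s : ℝ) = t - r - m := by
    have := congrArg (Nat.cast (R := ℝ)) hs
    push_cast at this
    linarith
  push_cast [hpos, hdeep, hpred, Nat.add_sub_cancel] at hB ⊢
  calc (B #S : ℝ) ≤ _ := hB
    _ = _ := by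
      rw [mul_left_comm (m : ℝ), hm, hsr]
      ring

theorem card_shallow_le (hs : q + m + s = t + 1) (h3 : 3 ≤ s) (hn : 2 ^ t < n) :
    (2 ^ q - 1) * 2 ^ m * (s + 1) ≤ n := by
  obtain ⟨r, rfl⟩ := Nat.exists_eq_add_of_le' h3
  have hr : r + 4 ≤ 2 ^ (r + 2) := by
    have := Nat.lt_two_pow_self (n := r)
    rw [pow_add]
    omega
  calc (2 ^ q - 1) * 2 ^ m * (r + 4) ≤ 2 ^ q * 2 ^ m * 2 ^ (r + 2) := by
        gcongr
        exact Nat.sub_le _ _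
    _ = 2 ^ t := by rw [← pow_add, ← pow_add]; congr 1; omega
    _ ≤ n := hn.le

theorem B_le_of_shallow_le (hk : k ≤ t + 1) (hn : 2 ^ t < n)
    (h₁ : (2 ^ k - 1) * (t + 1 - k + 1) ≤ n) (h₂ : n ≤ (2 ^ k - 1) * 2 ^ (t + 1 - k)) :
    (sizes n).Nonempty ∧
      (B n : ℝ) ≤ (k + 1) * n - ((t : ℝ) - k / 2 + 2) * 2 ^ k + t - k + 2 := by
  refine (B_le (q := k) (m := 0) (s := t + 1 - k) (by omega) hn (by simpa using h₁)
    (by simpa using h₂)).imp_right fun h => h.trans_eq ?_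
  push_cast
  ring

theorem saving_le {t p q Q Z : ℝ} (hp : 1 ≤ p) (hq : 2 ≤ q) (ht : 2 * (p + q) + 1 ≤ t)
    (hQ : 4 ≤ Q) (hZ : 0 ≤ Z) :
    (t - (p + q) / 2 + p + 2) * (Q * Z) - (t - (p + q)) + (p - 2) * Z ≤
      8 * Z * ((t + 2 - 3 * (p + 3) / 2) * (Q - 1) - q * (Q / 2 - 1)) := by
  have h : (t - (p + q) / 2 + p + 2) * Q + (p - 2) ≤
      8 * ((t + 2 - 3 * (p + 3) / 2) * (Q - 1) - q * (Q / 2 - 1)) := by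
    have h₁ : 0 ≤ (Q - 4) * (2 * (t - 3 / 2 * p - q / 2 - 5 / 2)) :=
      mul_nonneg (by linarith) (by linarith)
    have h₂ : 0 ≤ (Q - 4) * p := mul_nonneg (by linarith) (by linarith)
    have h₃ : 0 ≤ Q * (5 * t - 39 / 4 * p - 5 / 2 * q - 17) :=
      mul_nonneg (by linarith) (by linarith)
    linarith
  linarith [mul_le_mul_of_nonneg_right h hZ]

theorem two_le_of_two_pow_lt (hn : 2 ^ t < n) (h : n ≤ (2 ^ q - 1) * 2 ^ (t + 1 - q)) : 2 ≤ q := by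
  by_contra! hq
  interval_cases q
  · simp_all
  · exact hn.not_ge (by simpa using h)

/-- The inner cube of dimension `p + 3` pays for the smaller outer dimension `q`, except for
`t = 7`, `p = 1`, `q = 2`, where it would leave trees of dimension `2` only. -/
theorem B_le_of_one_le (hp : 1 ≤ p) (hpq : 2 * (p + q) < t) (hn : 2 ^ t < n)
    (hnq : n ≤ (2 ^ q - 1) * 2 ^ (t + 1 - q)) :
    (sizes n).Nonempty ∧ (B n : ℝ) ≤ (q + 1) * n
      - ((t : ℝ) - (p + q) / 2 + p + 2) * 2 ^ (p + q) + t - (p + q) - ((p : ℝ) - 2) * 2 ^ p := by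
  have hq := two_le_of_two_pow_lt hn hnq
  have hB : ∀ {m s : ℕ}, q + m + s = t + 1 → 3 ≤ s → (sizes n).Nonempty ∧ (B n : ℝ) ≤
      (q + 1) * n - 2 ^ m * ((t + 2 - 3 * m / 2) * (2 ^ q - 1) - q * (2 ^ q / 2 - 1)) :=
    fun {m s} hs h3 => B_le hs hn (card_shallow_le hs h3 hn) <| by
      rwa [mul_assoc, ← pow_add, show m + s = t + 1 - q by omega]
  by_cases h7 : t = 7 ∧ p = 1 ∧ q = 2
  · obtain ⟨rfl, rfl, rfl⟩ := h7
    refine (hB (m := 3) (s := 3) (by norm_num) le_rfl).imp_right fun h => h.trans ?_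
    norm_num
    linarith
  · refine (hB (m := p + 3) (s := t - (p + q) - 2) (by omega) (by omega)).imp_right
      fun h => h.trans ?_
    have hQ : (2 : ℝ) ^ 2 ≤ 2 ^ q := pow_le_pow_right₀ one_le_two hq
    have hsize := saving_le (t := t) (p := p) (q := q) (Q := 2 ^ q) (Z := 2 ^ p)
      (mod_cast hp) (mod_cast hq) (mod_cast hpq) (by linarith) (by positivity)
    push_cast
    rw [pow_add, pow_add]
    linarith

theorem le_and_le_of_eq_log (hn : n ≤ (2 ^ k - 1) * 2 ^ w)
    (hp : p = Nat.log 2 (((2 ^ k - 1) * 2 ^ w - n) / 2 ^ w + 1)) :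
    p ≤ k ∧ n ≤ (2 ^ (k - p) - 1) * 2 ^ (p + w) := by
  set d := (2 ^ k - 1) * 2 ^ w - n
  have hpd : 2 ^ p ≤ d / 2 ^ w + 1 := hp ▸ Nat.pow_log_le_self 2 (Nat.succ_ne_zero _)
  have hdk : d / 2 ^ w + 1 ≤ 2 ^ k := by
    have : d / 2 ^ w ≤ 2 ^ k - 1 := Nat.div_le_of_le_mul ((Nat.sub_le _ _).trans_eq (mul_comm _ _))
    have := Nat.one_le_two_pow (n := k)
    omega
  have hpk : p ≤ k := (Nat.pow_le_pow_iff_right one_lt_two).1 (hpd.trans hdk)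
  refine ⟨hpk, ?_⟩
  have hd' : (2 ^ p - 1) * 2 ^ w ≤ d :=
    (Nat.mul_le_mul_right _ (tsub_le_iff_right.2 hpd)).trans (Nat.div_mul_le_self d (2 ^ w))
  calc n = (2 ^ k - 1) * 2 ^ w - d := (Nat.sub_sub_self hn).symm
    _ ≤ (2 ^ k - 1) * 2 ^ w - (2 ^ p - 1) * 2 ^ w := Nat.sub_le_sub_left hd' _
    _ = (2 ^ k - 2 ^ p) * 2 ^ w := by
      rw [← Nat.sub_mul]
      have := Nat.one_le_two_pow (n := p)
      congr 1
      omega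
    _ = (2 ^ (k - p) - 1) * 2 ^ (p + w) := by
      rw [pow_add, ← mul_assoc, Nat.sub_mul (2 ^ (k - p)), ← pow_add, one_mul,
        Nat.sub_add_cancel hpk]

theorem two_pow_lt_sub_one_mul (hk2 : 2 ≤ k) (hk : k ≤ t + 1) :
    2 ^ t < (2 ^ k - 1) * 2 ^ (t + 1 - k) := by
  obtain ⟨j, rfl⟩ := Nat.exists_eq_add_of_le' hk2
  obtain ⟨i, rfl⟩ := Nat.exists_eq_add_of_le' (show j + 1 ≤ t by omega)
  have hj := Nat.one_le_two_pow (n := j)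
  calc 2 ^ (i + (j + 1)) = 2 ^ (j + 1) * 2 ^ i := by rw [pow_add, mul_comm]
    _ < (2 ^ (j + 2) - 1) * 2 ^ i := by
      gcongr
      rw [pow_succ, pow_succ]
      omega
    _ = _ := by rw [show i + (j + 1) + 1 - (j + 2) = i by omega]

end Bounds

end Broadcast

theorem theorem1p2_general (t k n N : ℕ) (hk2 : 2 ≤ k) (hk : k ≤ t + 1)
    (hN : N = (2 ^ k - 1) * 2 ^ (t + 1 - k)) :
    (n = N →
      (Broadcast.sizes n).Nonempty ∧
      (Broadcast.B n : ℝ) ≤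
        ((k : ℝ) + 1) * N - ((t : ℝ) - (k : ℝ) / 2 + 2) * 2 ^ k + t - k + 2) ∧
    (2 * k < t → 2 ^ t < n → n < N → ∀ d x p : ℕ,
      d = N - n → x = d / 2 ^ (t + 1 - k) → p = (if 0 < x then Nat.log 2 (x + 1) else 0) →
      (Broadcast.sizes n).Nonempty ∧
      (Broadcast.B n : ℝ) ≤
        ((k : ℝ) + 1 - p) * n - ((t : ℝ) - (k : ℝ) / 2 + p + 2) * 2 ^ k + t - k
          - ((p : ℝ) - 2) * 2 ^ p) := by
  constructor
  · rintro rfl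
    refine Broadcast.B_le_of_shallow_le hk (hN ▸ Broadcast.two_pow_lt_sub_one_mul hk2 hk) ?_ hN.le
    exact hN ▸ Nat.mul_le_mul_left _ (Nat.lt_two_pow_self (n := t + 1 - k))
  · rintro hkt hn hnN d x p rfl rfl hp
    have hp : p = Nat.log 2 ((N - n) / 2 ^ (t + 1 - k) + 1) := by
      split_ifs at hp with hx
      · exact hp
      · simp [hp, Nat.eq_zero_of_not_pos hx]
    obtain rfl | hp₁ := Nat.eq_zero_or_pos p
    · have hs := Broadcast.card_shallow_le (q := k) (m := 0) (s := t + 1 - k)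
        (by omega) (by omega) hn
      refine (Broadcast.B_le_of_shallow_le hk hn (by simpa using hs) (hN ▸ hnN.le)).imp_right
        fun h => h.trans_eq ?_
      push_cast
      ring
    · obtain ⟨hpk, hnp⟩ := Broadcast.le_and_le_of_eq_log (hN ▸ hnN.le) (hN ▸ hp)
      obtain ⟨q, rfl⟩ := Nat.exists_eq_add_of_le hpk
      rw [Nat.add_sub_cancel_left, show p + (t + 1 - (p + q)) = t + 1 - q by omega] at hnp
      refine (Broadcast.B_le_of_one_le hp₁ hkt hn hnp).imp_right fun h => h.trans_eq ?_
      push_cast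
      ring

theorem theorem1p2 (t k n N : ℕ) (ht : 7 ≤ t) (hk2 : 2 ≤ k)
    (hk : k ≤ t / 2 - 1 ∨ (Odd n ∧ k ≤ (t + 1) / 2 - 1))
    (hN : N = (2 ^ k - 1) * 2 ^ (t + 1 - k)) :
    (n = N →
      (Broadcast.sizes n).Nonempty ∧
      (Broadcast.B n : ℝ) ≤
        ((k : ℝ) + 1) * N - ((t : ℝ) - (k : ℝ) / 2 + 2) * 2 ^ k + t - k + 2) ∧
    (2 ^ t < n → n < N → ∀ d x p : ℕ,
      d = N - n → x = d / 2 ^ (t + 1 - k) → p = (if 0 < x then Nat.log 2 (x + 1) else 0) →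
      (Broadcast.sizes n).Nonempty ∧
      (Broadcast.B n : ℝ) ≤
        ((k : ℝ) + 1 - p) * n - ((t : ℝ) - (k : ℝ) / 2 + p + 2) * 2 ^ k + t - k
          - ((p : ℝ) - 2) * 2 ^ p) :=
  (theorem1p2_general t k n N hk2 (by omega) hN).imp_right fun h => h (by omega)
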